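/- Let $n\ge 0$ and let $\lambda=(\lambda_1\ge\dots\ge\lambda_n\ge 0)$ be a partition, identified with its left-justified shape having $n$ rows of lengths $\lambda_1,\dots,\lambda_n$. Let $R_\lambda=\{q_1<\dots<q_r\}$ be the set of the lengths of the columns of $\lambda$ that are less than $n$, put $q_0:=0$, $q_{r+1}:=n$, and call the intervals $(q_{h-1},q_h]=\{q_{h-1}+1,\dots,q_h\}$, $1\le h\le r+1$, the carrels. Let $\beta=(\beta_1,\dots,\beta_n)$ be an upper $\lambda$-tuple, i.e. $\beta_i\in\{1,\dots,n\}$ and $\beta_i\ge i$ for all $i$. In the $h$-th carrel define the critical indices of $\beta$ from right to left: $x_1:=q_h$, and, as long as it exists, $x_u$ is the maximal index with $q_{h-1}<x_u<x_{u-1}$ and $\beta_{x_{u-1}}-\beta_{x_u}>x_{u-1}-x_u$. For an index $i$ let $x(i)$ be the smallest critical index $\ge i$ in the carrel of $i$. Then $\beta\in UGC_\lambda(n)$ (gapless core) means that for every $h\in\{1,\dots,r\}$ one has $\beta_{q_h}\le\beta_k$, where $k$ is the leftmost critical index of the carrel $(q_h,q_{h+1}]$; and $\beta\in UBP_\lambda(n)$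 (bounded by its platform) means that $\beta_i\le\beta_{x(i)}$ for all $i$. Let $s_\lambda(\beta;x)=\sum_T x_1^{\theta_1(T)}\cdots x_n^{\theta_n(T)}$, where $T$ runs over the semistandard tableaux of shape $\lambda$ with values in $\{1,\dots,n\}$ (rows weakly increasing, columns strictly increasing) whose values in row $i$ are at most $\beta_i$ for every $i$, and $\theta_k(T)$ is the number of values of $T$ equal to $k$. For integers $u$ and $1\le i,k\le n$ let $h_u(i,k;x):=0$ if $u<0$ and otherwise $h_u(i,k;x):=\sum_{i\le t_1\le\dots\le t_u\le k}x_{t_1}\cdots x_{t_u}$. If $\beta\in UGC_\lambda(n)\cap UBP_\lambda(n)$, then, as polynomials in $\mathbb{Z}[x_1,\dots,x_n]$, $$ s_\lambda(\beta;x)=\det\bigl(h_{\lambda_j-j+i}(i,\beta_j;x)\bigr)_{1\le i,j\le n}. $$ -/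

import Mathlib

/-!
Conventions: everything is indexed from `0`.  The index `i : Fin n` stands for the index `i + 1`
of `[n] = {1, …, n}`, and likewise for the entries of `n`-tuples with entries in `[n]`
(elements of `Fin n → Fin n`), for the values of tableaux and for the variables.
A divider `q ∈ R ⊆ {1, …, n - 1}` is not shifted: it separates the first `q` indices from the
remaining ones, i.e. the indices `i < q` from the indices `q ≤ i`.
-/

namespace RowBound

open Finset

/-! ### `R`-tuples -/

section Tuples

variable {n : ℕ}

/-- Upper tuples: `β i ≥ i` for all `i`. -/
def U (n : ℕ) : Set (Fin n → Fin n) := {β | ∀ i, i ≤ β i}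

/-- `i` and `k` lie in the same carrel: no divider `q ∈ R` separates them. -/
def SameCarrel (R : Finset ℕ) (i k : Fin n) : Prop :=
  ∀ q ∈ R, q ≤ (i : ℕ) ↔ q ≤ (k : ℕ)

/-- `i` is the last index of its carrel: a divider (or the end of the tuple) follows it. -/
def IsCarrelEnd (R : Finset ℕ) (i : Fin n) : Prop :=
  (i : ℕ) + 1 ∈ R ∨ (i : ℕ) + 1 = n

/-- `β_y - β_x > y - x`, as integers. -/
def SteepRise (β : Fin n → Fin n) (x y : Fin n) : Prop :=
  ((y : ℕ) : ℤ) - ((x : ℕ) : ℤ) < ((β y : ℕ) : ℤ) - ((β x : ℕ) : ℤ)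

/-- The critical indices of `β`, found from the right within each carrel: the last index of the
carrel is critical, and the next critical index to the left of a critical index `y` is the maximal
`x < y` in the same carrel (if there is one) with `β_y - β_x > y - x`. -/
inductive IsCritical (R : Finset ℕ) (β : Fin n → Fin n) : Fin n → Prop
  | last (x : Fin n) (hx : IsCarrelEnd R x) : IsCritical R β x
  | next (x y : Fin n) (hy : IsCritical R β y) (hxy : x < y) (hc : SameCarrel R x y)
      (hd : SteepRise β x y) (hmax : ∀ z, x < z → z < y → ¬ SteepRise β z y) : IsCritical R β x

theorem exists_critical (R : Finset ℕ) (β : Fin n → Fin n) (i : Fin n) :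
    ∃ x, IsCritical R β x ∧ SameCarrel R i x ∧ i ≤ x := by
  classical
  have hne : (univ.filter fun x : Fin n => SameCarrel R i x ∧ i ≤ x).Nonempty :=
    ⟨i, mem_filter.2 ⟨mem_univ _, fun _ _ => Iff.rfl, le_rfl⟩⟩
  obtain ⟨x, hx, hmax⟩ := exists_max_image _ (fun x : Fin n => (x : ℕ)) hne
  simp only [mem_filter, mem_univ, true_and] at hx hmax
  refine ⟨x, .last x ?_, hx⟩
  by_contra hcon
  simp only [IsCarrelEnd, not_or] at hcon
  have hlt : (x : ℕ) + 1 < n := by have := x.2; omega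
  have hix : (i : ℕ) ≤ x := hx.2
  have := hmax ⟨x + 1, hlt⟩ ⟨fun q hq => ?_, Fin.le_def.2 (by simp; omega)⟩
  · simp at this
  · have h1 := hx.1 q hq
    have h2 : q ≠ (x : ℕ) + 1 := fun h => hcon.1 (h ▸ hq)
    simp only
    omega

open Classical in
/-- The first critical index at or to the right of `i` within the carrel of `i`. -/
noncomputable def nextCritical (R : Finset ℕ) (β : Fin n → Fin n) (i : Fin n) : Fin n :=
  (univ.filter fun x => IsCritical R β x ∧ SameCarrel R i x ∧ i ≤ x).min'
    (by obtain ⟨x, hx⟩ := exists_critical R β i; exact ⟨x, by simpa using hx⟩)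

/-- The `R`-platform `Ξ_R(β)`: its entry at `i` is the critical entry `β_x` at the
first critical index `x ≥ i` in the carrel of `i`. -/
noncomputable def platform (R : Finset ℕ) (β : Fin n → Fin n) : Fin n → Fin n :=
  fun i => β (nextCritical R β i)

/-- The critical list of `β` is a flag critical list: for each divider `q ∈ R`, the (critical)
entry at the last index `i` before `q` is at most the critical entry at the leftmost critical
index `k` of the carrel that begins right after `q`, with first index `j`. -/
def HasFlagCriticalList (R : Finset ℕ) (β : Fin n → Fin n) : Prop :=
  ∀ q ∈ R, ∀ i j k : Fin n, (i : ℕ) + 1 = q → (j : ℕ) = q →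
    IsLeast {x | IsCritical R β x ∧ SameCarrel R j x} k → β i ≤ β k

/-- Gapless core `R`-tuples. -/
def UGC (n : ℕ) (R : Finset ℕ) : Set (Fin n → Fin n) :=
  {β | β ∈ U n ∧ HasFlagCriticalList R β}

/-- Upper `R`-tuples that are bounded by their platform. -/
def UBP (n : ℕ) (R : Finset ℕ) : Set (Fin n → Fin n) :=
  {β | β ∈ U n ∧ β ≤ platform R β}

end Tuples

/-! ### Shapes, tableaux, polynomials -/

section Tableaux

variable {n : ℕ}

/-- The shape of the partition `lam 0 ≥ lam 1 ≥ … ≥ lam (n - 1) ≥ 0`: the boxes are the pairs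
(row `i`, column `j`) with `i < n` and `j < lam i`. -/
def shape (lam : Fin n → ℕ) (hlam : Antitone lam) : YoungDiagram where
  cells := univ.biUnion fun i : Fin n => (range (lam i)).image fun j => ((i : ℕ), j)
  isLowerSet := by
    rintro ⟨a, b⟩ ⟨c, d⟩ ⟨hca, hdb⟩ h
    simp only [coe_biUnion, Set.mem_iUnion, mem_coe, mem_image, mem_range, Prod.mk.injEq,
      mem_univ, exists_prop, true_and] at h ⊢
    obtain ⟨i, j, hj, rfl, rfl⟩ := h
    simp only at hca hdb
    have hcn : c < n := lt_of_le_of_lt hca i.2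
    have hle : lam i ≤ lam ⟨c, hcn⟩ := hlam (Fin.le_def.2 hca)
    exact ⟨⟨c, hcn⟩, d, by omega, rfl, rfl⟩

/-- `R_λ`: the set of the lengths of the columns of the shape `λ` that are less than `n`. -/
def colLengths (lam : Fin n → ℕ) (hlam : Antitone lam) : Finset ℕ :=
  ((range ((shape lam hlam).rowLen 0)).image (shape lam hlam).colLen).filter (· < n)

/-- The row bound set of tableaux: the semistandard tableaux `T` of shape `λ` with values in
`{0, …, n - 1}` whose values in row `i` are at most `β i`. -/
def rowBoundSet (lam : Fin n → ℕ) (hlam : Antitone lam) (β : Fin n → Fin n) :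
    Set (SemistandardYoungTableau (shape lam hlam)) :=
  {T | (∀ c ∈ (shape lam hlam).cells, T c.1 c.2 < n) ∧
    ∀ i : Fin n, ∀ j < lam i, T i j ≤ (β i : ℕ)}

theorem rowBoundSet_finite (lam : Fin n → ℕ) (hlam : Antitone lam) (β : Fin n → Fin n) :
    (rowBoundSet lam hlam β).Finite := by
  let f : rowBoundSet lam hlam β → ((shape lam hlam).cells → Fin n) :=
    fun T c => ⟨T.1 c.1.1 c.1.2, T.2.1 c.1 c.2⟩
  have hf : Function.Injective f := by
    rintro ⟨S, hS⟩ ⟨T, hT⟩ h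
    apply Subtype.ext
    apply SemistandardYoungTableau.ext
    intro i j
    by_cases hc : (i, j) ∈ shape lam hlam
    · have := congrFun h ⟨(i, j), hc⟩
      simpa [f] using this
    · simp only
      rw [S.zeros hc, T.zeros hc]
  exact Set.finite_coe_iff.1 (Finite.of_injective f hf)

/-- The content of `T`: the number of boxes of `T` with value `k`. -/
def content {μ : YoungDiagram} (T : SemistandardYoungTableau μ) (k : ℕ) : ℕ :=
  (μ.cells.filter fun c => T c.1 c.2 = k).card

/-- The row bound sum `s_λ(β; x)`. -/
noncomputable def rowBoundSum (lam : Fin n → ℕ) (hlam : Antitone lam) (β : Fin n → Fin n) :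
    MvPolynomial (Fin n) ℤ :=
  ∑ T ∈ (rowBoundSet_finite lam hlam β).toFinset,
    ∏ k : Fin n, MvPolynomial.X k ^ content T k

open Classical in
/-- `h_u(i, k; x)`: zero for `u < 0`, otherwise the sum of `x_{t_1} ⋯ x_{t_u}` over all
`i ≤ t_1 ≤ … ≤ t_u ≤ k`. -/
noncomputable def completeHom (u : ℤ) (i k : Fin n) : MvPolynomial (Fin n) ℤ :=
  if u < 0 then 0
  else ∑ t : Fin u.toNat → Fin n with Monotone t ∧ ∀ s, i ≤ t s ∧ t s ≤ k,
    ∏ s, MvPolynomial.X (t s)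

end Tableaux

end RowBound

/-!
Write the determinant and the tableau sum for arbitrary bounds on the rows.  Since the columns of a
tableau increase strictly, the bound of a row is implied by the bound of a lower row of the same
length when the difference of the bounds is at most the distance of the rows.  Relaxing the bounds
to such implied bounds changes no tableau, and it changes the determinant only by column
operations, by `h_u(i, k) = h_u(i, k - 1) + x_k h_{u - 1}(i, k)`.  By the definition of the critical
indices, `β` may therefore be replaced by its platform, and the platform is weakly increasing
because the critical list is a flag.

For weakly increasing bounds (the flagged Jacobi–Trudi identity) let `p` be the first row with the
maximal bound `m`.  Both sides satisfy the recursion that splits off the tableaux with the value `m`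
at the end of row `p`: lower the bound of that row, or remove its last box.  If that box is not a
corner, then no tableau is split off, and correspondingly the determinant for the removed box
vanishes.
-/

namespace RowBound

open Finset

/-! ### Complete homogeneous polynomials -/

section CompleteHomogeneous

variable {α A : Type*} [LinearOrder α] [CommSemiring A] {s : Finset α}

open Classical in
/-- The weakly increasing sequences of length `u` with entries in `s`; they index the monomials
of degree `u` in variables indexed by `s`. -/
noncomputable def monotoneTuples (s : Finset α) (u : ℕ) : Finset (Fin u → α) :=
  {t ∈ Fintype.piFinset fun _ => s | Monotone t}

theorem mem_monotoneTuples {u : ℕ} {t : Fin u → α} :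
    t ∈ monotoneTuples s u ↔ (∀ r, t r ∈ s) ∧ Monotone t := by
  simp [monotoneTuples]

theorem monotone_snoc_iff {α : Type*} [Preorder α] {u : ℕ} {t : Fin u → α} {a : α} :
    Monotone (Fin.snoc t a : Fin (u + 1) → α) ↔ Monotone t ∧ ∀ r, t r ≤ a := by
  simp [Monotone, Fin.forall_fin_succ', (Fin.castSucc_lt_last _).not_ge, forall_and, Fin.le_last]

/-- The complete homogeneous polynomial of degree `u` in the elements `x a`, `a ∈ s`. -/
noncomputable def hsymm (x : α → A) (s : Finset α) (u : ℕ) : A :=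
  ∑ t ∈ monotoneTuples s u, ∏ r, x (t r)

/-- The complete homogeneous polynomial with an integral degree; it vanishes in negative
degrees. -/
noncomputable def hsymmInt (x : α → A) (s : Finset α) (u : ℤ) : A :=
  if u < 0 then 0 else hsymm x s u.toNat

theorem monotoneTuples_insert {a : α} (ha : ∀ b ∈ s, b < a) (u : ℕ) :
    monotoneTuples (insert a s) (u + 1) = monotoneTuples s (u + 1) ∪
      (monotoneTuples (insert a s) u).image fun t => Fin.snoc t a := by
  ext t
  simp only [mem_union, mem_image, mem_monotoneTuples]
  constructor
  · rintro ⟨hmem, ht⟩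
    rcases mem_insert.1 (hmem (Fin.last u)) with hlast | hlast
    · rw [← Fin.snoc_init_self t, hlast] at ht
      exact .inr ⟨Fin.init t, ⟨fun r => hmem r.castSucc, (monotone_snoc_iff.1 ht).1⟩, by
        rw [← hlast, Fin.snoc_init_self]⟩
    · exact .inl ⟨fun r => (mem_insert.1 (hmem r)).resolve_left
        ((ht (Fin.le_last r)).trans_lt (ha _ hlast)).ne, ht⟩
  · rintro (⟨hmem, ht⟩ | ⟨t, ⟨hmem, ht⟩, rfl⟩)
    · exact ⟨fun r => mem_insert_of_mem (hmem r), ht⟩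
    · refine ⟨by simpa [Fin.forall_fin_succ'] using hmem, monotone_snoc_iff.2 ⟨ht, fun r => ?_⟩⟩
      exact (mem_insert.1 (hmem r)).elim le_of_eq fun h => (ha _ h).le

theorem hsymm_insert (x : α → A) {a : α} (ha : ∀ b ∈ s, b < a) (u : ℕ) :
    hsymm x (insert a s) (u + 1) = hsymm x s (u + 1) + x a * hsymm x (insert a s) u := by
  have hdisj : Disjoint (monotoneTuples s (u + 1))
      ((monotoneTuples (insert a s) u).image fun t => Fin.snoc t a) := by
    refine disjoint_left.2 fun t ht ht' => ?_
    obtain ⟨t, -, rfl⟩ := mem_image.1 ht'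
    simpa using ha _ ((mem_monotoneTuples.1 ht).1 (Fin.last u))
  rw [hsymm, monotoneTuples_insert ha, sum_union hdisj,
    sum_image (Fin.snoc_left_injective (α := fun _ => α) a).injOn, hsymm, hsymm, mul_sum]
  simp [Fin.prod_univ_castSucc, mul_comm]

theorem hsymmInt_natCast (x : α → A) (s : Finset α) (u : ℕ) :
    hsymmInt x s u = hsymm x s u := by
  simp [hsymmInt]

theorem hsymmInt_of_neg (x : α → A) (s : Finset α) {u : ℤ} (hu : u < 0) : hsymmInt x s u = 0 :=
  if_pos hu

theorem hsymmInt_zero (x : α → A) (s : Finset α) : hsymmInt x s 0 = 1 := by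
  simp [hsymmInt, hsymm, monotoneTuples, Subsingleton.monotone]

theorem hsymmInt_empty (x : α → A) {u : ℤ} (hu : u ≠ 0) : hsymmInt x ∅ u = 0 := by
  rcases hu.lt_or_gt with hu | hu
  · exact hsymmInt_of_neg x ∅ hu
  · obtain ⟨v, rfl⟩ : ∃ v : ℕ, u = v + 1 := ⟨(u - 1).toNat, by omega⟩
    rw [← Nat.cast_succ, hsymmInt_natCast, hsymm, monotoneTuples]
    simp

theorem hsymmInt_insert (x : α → A) {a : α} (ha : ∀ b ∈ s, b < a) (u : ℤ) :
    hsymmInt x (insert a s) u = hsymmInt x s u + x a * hsymmInt x (insert a s) (u - 1) := by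
  rcases lt_trichotomy u 0 with hu | rfl | hu
  · simp [hsymmInt_of_neg, hu, hu.trans zero_lt_one]
  · simp [hsymmInt_zero, hsymmInt_of_neg]
  · lift u to ℕ using hu.le
    obtain ⟨u, rfl⟩ : ∃ v, u = v + 1 := Nat.exists_eq_add_one.2 (by exact_mod_cast hu)
    rw [Nat.cast_succ, add_sub_cancel_right, ← Nat.cast_succ]
    simpa only [hsymmInt_natCast] using hsymm_insert x ha u

theorem hsymm_map {α' : Type*} [LinearOrder α'] (f : α ↪o α') (x : α' → A) (s : Finset α) (u : ℕ) :
    hsymm x (s.map f.toEmbedding) u = hsymm (x ∘ f) s u := by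
  refine (sum_bij (fun t _ r => f (t r)) (fun t ht => ?_) (fun t _ t' _ h => ?_) (fun t ht => ?_)
    fun _ _ => rfl).symm
  · rw [mem_monotoneTuples] at ht ⊢
    exact ⟨fun r => mem_map_of_mem _ (ht.1 r), f.monotone.comp ht.2⟩
  · exact funext fun r => f.injective (congrFun h r)
  · rw [mem_monotoneTuples] at ht
    choose t' ht' hft' using fun r => mem_map.1 (ht.1 r)
    have hmono : Monotone t' := fun r r' h => by
      simpa only [← hft', RelEmbedding.coe_toEmbedding, f.le_iff_le] using ht.2 h
    exact ⟨t', mem_monotoneTuples.2 ⟨ht', hmono⟩, funext hft'⟩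

end CompleteHomogeneous

/-! ### Flagged Jacobi–Trudi determinants -/

section JacobiTrudi

variable {A : Type*} [CommRing A] {x : ℕ → A} {n : ℕ}

/-- A column of the Jacobi–Trudi matrix: in row `i` the complete homogeneous polynomial of degree
`a + i` in `x i, …, x (k - 1)`. -/
noncomputable def jtCol (x : ℕ → A) (n : ℕ) (a : ℤ) (k : ℕ) : Fin n → A :=
  fun i => hsymmInt x (Ico (i : ℕ) k) (a + (i : ℕ))

/-- The flagged Jacobi–Trudi matrix with degrees `a` (in row `0`) and exclusive upper bounds `k`
of the variables. -/
noncomputable def jtMatrix (x : ℕ → A) (a : Fin n → ℤ) (k : Fin n → ℕ) : Matrix (Fin n) (Fin n) A :=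
  Matrix.of fun i j => jtCol x n (a j) (k j) i

theorem jtCol_add_one {a : ℤ} {k : ℕ} (h : ∀ i : Fin n, i ≤ k ∨ a + i ≠ 1) :
    jtCol x n a (k + 1) = jtCol x n a k + x k • jtCol x n (a - 1) (k + 1) := by
  ext i
  simp only [jtCol, Pi.add_apply, Pi.smul_apply, smul_eq_mul, sub_add_eq_add_sub]
  obtain hik | hki := le_or_gt (i : ℕ) k
  · rw [← insert_Ico_right_eq_Ico_add_one hik]
    exact hsymmInt_insert x (fun b hb => (mem_Ico.1 hb).2) _
  · rw [Ico_eq_empty (by lia), Ico_eq_empty (by lia),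
      hsymmInt_empty x (sub_ne_zero.2 ((h i).resolve_left hki.not_ge))]
    simp

theorem updateCol_jtMatrix (x : ℕ → A) (a : Fin n → ℤ) (k : Fin n → ℕ) (p : Fin n) (a' : ℤ)
    (k' : ℕ) : (jtMatrix x a k).updateCol p (jtCol x n a' k') =
      jtMatrix x (Function.update a p a') (Function.update k p k') := by
  ext i j
  obtain rfl | hj := eq_or_ne j p <;> simp [jtMatrix, *]

theorem det_jtMatrix_eq_add {a : Fin n → ℤ} {k : Fin n → ℕ} {p : Fin n} {m : ℕ}
    (hp : k p = m + 1) (hm : n ≤ m + 1) :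
    (jtMatrix x a k).det = (jtMatrix x a (Function.update k p m)).det +
      x m * (jtMatrix x (Function.update a p (a p - 1)) k).det := by
  have hcol : jtCol x n (a p) (k p) = jtCol x n (a p) m + x m • jtCol x n (a p - 1) (k p) := by
    rw [hp]
    exact jtCol_add_one fun i => .inl (by lia)
  have hsplit := congrArg (fun v => ((jtMatrix x a k).updateCol p v).det) hcol
  simpa only [Matrix.det_updateCol_add, Matrix.det_updateCol_smul, updateCol_jtMatrix,
    Function.update_eq_self] using hsplit

theorem jtCol_last {k : ℕ} (hk : k ≤ n) (a : ℤ) :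
    jtCol x (n + 1) a k (Fin.last n) = if a + n = 0 then 1 else 0 := by
  rw [jtCol, Fin.val_last, Ico_eq_empty hk.not_gt]
  split_ifs with h
  · rw [h, hsymmInt_zero]
  · exact hsymmInt_empty x h

theorem det_jtMatrix_castSucc {a : Fin (n + 1) → ℤ} {k : Fin (n + 1) → ℕ} (hk : ∀ j, k j ≤ n)
    (ha : ∀ j : Fin n, a j.castSucc + n ≠ 0) :
    (jtMatrix x a k).det = if a (Fin.last n) + n = 0 then
      (jtMatrix x (fun j => a j.castSucc) fun j => k j.castSucc).det else 0 := by
  have hrow (j) : jtMatrix x a k (Fin.last n) j = if a j + n = 0 then 1 else 0 :=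
    jtCol_last (hk j) (a j)
  have hminor : (jtMatrix x a k).submatrix Fin.castSucc Fin.castSucc =
      jtMatrix x (fun j => a j.castSucc) fun j => k j.castSucc := rfl
  simp [Matrix.det_succ_row _ (Fin.last n), Fin.sum_univ_castSucc, hrow, ha, hminor,
    ← two_mul, pow_mul]

theorem det_jtMatrix_eq_zero_of_eq {a : Fin n → ℤ} {k : Fin n → ℕ} {p q : Fin n} (hpq : p ≠ q)
    (ha : a p = a q) (hk : k p = k q) : (jtMatrix x a k).det = 0 :=
  Matrix.det_zero_of_column_eq hpq fun i => by simp [jtMatrix, ha, hk]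

theorem det_jtMatrix_eq_zero_of_neg {a : Fin n → ℤ} {k : Fin n → ℕ} {p : Fin n}
    (ha : ∀ i : Fin n, a p + i < 0) : (jtMatrix x a k).det = 0 :=
  Matrix.det_eq_zero_of_column_eq_zero p fun i => hsymmInt_of_neg x _ (ha i)

end JacobiTrudi

/-! ### Flagged tableaux -/

section Tableaux

variable {μ : YoungDiagram}

theorem entry_add_sub_le (T : SemistandardYoungTableau μ) {i k j : ℕ} (hik : i ≤ k)
    (h : (k, j) ∈ μ) : T i j + (k - i) ≤ T k j := by
  induction k, hik using Nat.le_induction with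
  | base => simp
  | succ k hik ih =>
    have hstrict := T.col_strict k.lt_succ_self h
    have := ih (μ.up_left_mem k.le_succ le_rfl h)
    lia

/-- The restriction of a tableau to a smaller shape. -/
def restrict {ν : YoungDiagram} (h : ν ≤ μ) (T : SemistandardYoungTableau μ) :
    SemistandardYoungTableau ν where
  entry i j := if (i, j) ∈ ν then T i j else 0
  row_weak' {i j₁ j₂} hj hmem := by
    rw [if_pos hmem, if_pos (ν.up_left_mem le_rfl hj.le hmem)]
    exact T.row_weak hj (h hmem)
  col_strict' {i₁ i₂ j} hi hmem := by
    rw [if_pos hmem, if_pos (ν.up_left_mem hi.le le_rfl hmem)]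
    exact T.col_strict hi (h hmem)
  zeros' hmem := if_neg hmem

theorem restrict_apply {ν : YoungDiagram} (h : ν ≤ μ) (T : SemistandardYoungTableau μ) (i j : ℕ) :
    restrict h T i j = if (i, j) ∈ ν then T i j else 0 :=
  rfl

/-- The diagram obtained by removing a corner. -/
def removeCell (μ : YoungDiagram) (b : ℕ × ℕ) (hb : Maximal (· ∈ μ) b) : YoungDiagram where
  cells := μ.cells.erase b
  isLowerSet := by
    rw [coe_erase]
    exact μ.isLowerSet.erase fun c hc hbc => hb.eq_of_ge hc hbc

theorem mem_removeCell {b c : ℕ × ℕ} {hb : Maximal (· ∈ μ) b} :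
    c ∈ removeCell μ b hb ↔ c ≠ b ∧ c ∈ μ :=
  mem_erase

theorem removeCell_le {b : ℕ × ℕ} (hb : Maximal (· ∈ μ) b) : removeCell μ b hb ≤ μ :=
  erase_subset b μ.cells

theorem maximal_rowLen {p : ℕ} (h : μ.rowLen (p + 1) < μ.rowLen p) :
    Maximal (· ∈ μ) (p, μ.rowLen p - 1) := by
  refine ⟨YoungDiagram.mem_iff_lt_rowLen.2 (by lia), fun ⟨i, j⟩ hmem hle => ?_⟩
  rw [Prod.mk_le_mk] at hle ⊢
  have hj := YoungDiagram.mem_iff_lt_rowLen.1 hmem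
  have hip : i ≤ p := by
    by_contra! hpi
    have := μ.rowLen_anti (p + 1) i hpi
    lia
  have := μ.rowLen_anti p i hle.1
  lia

theorem rowLen_removeCell {p : ℕ} (hb : Maximal (· ∈ μ) (p, μ.rowLen p - 1)) :
    (removeCell μ _ hb).rowLen = Function.update μ.rowLen p (μ.rowLen p - 1) := by
  refine funext fun i => eq_of_forall_lt_iff fun j => ?_
  rw [← YoungDiagram.mem_iff_lt_rowLen, mem_removeCell, YoungDiagram.mem_iff_lt_rowLen,
    Function.update_apply, ne_eq, Prod.mk.injEq]
  split_ifs with h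
  · subst h
    lia
  · simp [h]

/-- Filling the removed corner `b` of a tableau with the value `m`. -/
def insertCell {b : ℕ × ℕ} {hb : Maximal (· ∈ μ) b}
    (T : SemistandardYoungTableau (removeCell μ b hb)) (m : ℕ)
    (hrow : ∀ j < b.2, T b.1 j ≤ m) (hcol : ∀ i < b.1, T i b.2 < m) :
    SemistandardYoungTableau μ where
  entry i j := if (i, j) = b then m else T i j
  row_weak' {i j₁ j₂} hj hmem := by
    have hne : (i, j₁) ≠ b := by
      rintro rfl
      exact hj.ne (Prod.mk.inj (hb.eq_of_le hmem ⟨le_rfl, hj.le⟩)).2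
    rw [if_neg hne]
    split_ifs with h
    · subst h
      exact hrow _ hj
    · exact T.row_weak hj (mem_removeCell.2 ⟨h, hmem⟩)
  col_strict' {i₁ i₂ j} hi hmem := by
    have hne : (i₁, j) ≠ b := by
      rintro rfl
      exact hi.ne (Prod.mk.inj (hb.eq_of_le hmem ⟨hi.le, le_rfl⟩)).1
    rw [if_neg hne]
    split_ifs with h
    · subst h
      exact hcol _ hi
    · exact T.col_strict hi (mem_removeCell.2 ⟨h, hmem⟩)
  zeros' {i j} hmem := by
    have hne : (i, j) ≠ b := fun h => hmem (h.symm ▸ hb.prop)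
    rw [if_neg hne]
    exact T.zeros fun h => hmem (mem_removeCell.1 h).2

theorem insertCell_apply {b : ℕ × ℕ} {hb : Maximal (· ∈ μ) b}
    (T : SemistandardYoungTableau (removeCell μ b hb)) {m : ℕ} (hrow : ∀ j < b.2, T b.1 j ≤ m)
    (hcol : ∀ i < b.1, T i b.2 < m) (i j : ℕ) :
    insertCell T m hrow hcol i j = if (i, j) = b then m else T i j :=
  rfl

theorem restrict_insertCell {b : ℕ × ℕ} {hb : Maximal (· ∈ μ) b}
    (T : SemistandardYoungTableau (removeCell μ b hb)) {m : ℕ} (hrow : ∀ j < b.2, T b.1 j ≤ m)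
    (hcol : ∀ i < b.1, T i b.2 < m) :
    restrict (removeCell_le hb) (insertCell T m hrow hcol) = T := by
  ext i j
  rw [restrict_apply, insertCell_apply]
  split_ifs with hmem h
  · exact absurd h (mem_removeCell.1 hmem).1
  · rfl
  · exact (T.zeros hmem).symm

end Tableaux

section FlaggedSchur

variable {A : Type*} [CommSemiring A] {x : ℕ → A} {μ : YoungDiagram} {n : ℕ} {c : Fin n → ℕ}

/-- The flagged tableaux: the values in row `i < n` are less than `c i`. -/
def boundedTableaux (μ : YoungDiagram) (c : Fin n → ℕ) : Set (SemistandardYoungTableau μ) :=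
  {T | ∀ (i : Fin n) (j : ℕ), ((i : ℕ), j) ∈ μ → T i j < c i}

theorem finite_boundedTableaux (hμ : ∀ b ∈ μ, b.1 < n) (c : Fin n → ℕ) :
    (boundedTableaux μ c).Finite := by
  let f (T : boundedTableaux μ c) (b : μ.cells) : Fin (c ⟨b.1.1, hμ b b.2⟩) :=
    ⟨T.1 b.1.1 b.1.2, T.2 ⟨b.1.1, hμ b b.2⟩ b.1.2 b.2⟩
  refine Set.finite_coe_iff.1 (Finite.of_injective f fun S T h => ?_)
  refine Subtype.ext (SemistandardYoungTableau.ext fun i j => ?_)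
  by_cases hmem : (i, j) ∈ μ
  · exact Fin.val_eq_of_eq (congrFun h ⟨(i, j), hmem⟩)
  · rw [S.1.zeros hmem, T.1.zeros hmem]

/-- The flagged Schur polynomial: the generating polynomial of the flagged tableaux. It is
meaningful if `μ` has at most `n` rows; otherwise the sum may be infinite and then has the junk
value `0`. -/
noncomputable def flaggedSchur (x : ℕ → A) (μ : YoungDiagram) (c : Fin n → ℕ) : A :=
  ∑ᶠ T ∈ boundedTableaux μ c, ∏ b ∈ μ.cells, x (T b.1 b.2)

theorem flaggedSchur_eq_one (hμ : ∀ b, b ∉ μ) (x : ℕ → A) (c : Fin n → ℕ) :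
    flaggedSchur x μ c = 1 := by
  have hcells : μ.cells = ∅ := eq_empty_of_forall_notMem hμ
  have hset : boundedTableaux μ c = {default} :=
    Set.eq_singleton_iff_unique_mem.2 ⟨fun _ _ hmem => absurd hmem (hμ _), fun T _ =>
      SemistandardYoungTableau.ext fun _ _ => (T.zeros (hμ _)).trans
        (SemistandardYoungTableau.zeros _ (hμ _)).symm⟩
  rw [flaggedSchur, hset, finsum_mem_singleton, hcells, prod_empty]

theorem flaggedSchur_castSucc {c : Fin (n + 1) → ℕ} (hc : c (Fin.last n) ≤ n) :
    flaggedSchur x μ c = if μ.rowLen n = 0 then flaggedSchur x μ fun i => c i.castSucc else 0 := by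
  split_ifs with h
  · have hset : boundedTableaux μ c = boundedTableaux μ fun i => c i.castSucc := by
      ext T
      simp [boundedTableaux, Fin.forall_fin_succ', YoungDiagram.mem_iff_lt_rowLen, h]
    rw [flaggedSchur, hset, flaggedSchur]
  · have hmem : (n, 0) ∈ μ := YoungDiagram.mem_iff_lt_rowLen.2 (Nat.pos_of_ne_zero h)
    have hset : boundedTableaux μ c = ∅ := Set.eq_empty_of_forall_notMem fun T hT => by
      have hlow := entry_add_sub_le T n.zero_le hmem
      have hup := hT (Fin.last n) 0 hmem
      rw [Fin.val_last] at hup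
      lia
    rw [flaggedSchur, hset, finsum_mem_empty]

variable {p : Fin n} {m : ℕ}

theorem boundedTableaux_update_subset (hp : c p = m + 1) :
    boundedTableaux μ (Function.update c p m) ⊆ boundedTableaux μ c := by
  intro T hT i j hmem
  have := hT i j hmem
  obtain rfl | hi := eq_or_ne i p
  · rw [Function.update_self] at this
    lia
  · rwa [Function.update_of_ne hi] at this

theorem boundedTableaux_update_of_not_corner (hp : c p = m + 1)
    (hnext : ∀ j, ((p : ℕ), j) ∈ μ → ∃ q : Fin n, p < q ∧ ((q : ℕ), j) ∈ μ ∧ c q ≤ m + 1) :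
    boundedTableaux μ (Function.update c p m) = boundedTableaux μ c := by
  refine (boundedTableaux_update_subset hp).antisymm fun T hT i j hmem => ?_
  obtain rfl | hi := eq_or_ne i p
  · obtain ⟨q, hq, hmem', hcq⟩ := hnext j hmem
    have hstrict := T.col_strict hq hmem'
    have := hT q j hmem'
    rw [Function.update_self]
    lia
  · rw [Function.update_of_ne hi]
    exact hT i j hmem

theorem boundedTableaux_eq_union (hp : c p = m + 1) {l : ℕ}
    (hb : Maximal (· ∈ μ) ((p : ℕ), l)) :
    boundedTableaux μ c =
      boundedTableaux μ (Function.update c p m) ∪ {T ∈ boundedTableaux μ c | T p l = m} := by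
  refine Set.Subset.antisymm (fun T hT => ?_)
    (Set.union_subset (boundedTableaux_update_subset hp) fun T hT => hT.1)
  have hTl : T p l < m + 1 := hp ▸ hT p l hb.prop
  obtain hlt | heq := (Nat.lt_succ_iff.1 hTl).lt_or_eq
  · refine .inl fun i j hmem => ?_
    obtain rfl | hi := eq_or_ne i p
    · rw [Function.update_self]
      have hjl : j ≤ l := not_lt.1 fun hlj =>
        hlj.ne (Prod.mk.inj (hb.eq_of_le hmem ⟨le_rfl, hlj.le⟩)).2
      exact (T.row_weak_of_le hjl hb.prop).trans_lt hlt
    · rw [Function.update_of_ne hi]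
      exact hT i j hmem
  · exact .inr ⟨hT, heq⟩

theorem disjoint_boundedTableaux_update {l : ℕ} (hb : ((p : ℕ), l) ∈ μ) :
    Disjoint (boundedTableaux μ (Function.update c p m)) {T ∈ boundedTableaux μ c | T p l = m} :=
  Set.disjoint_left.2 fun T hT hT' => by
    simpa [hT'.2] using hT p l hb

theorem bijOn_restrict_removeCell (hp : c p = m + 1) (hlt : ∀ i < p, c i ≤ m) {l : ℕ}
    (hb : Maximal (· ∈ μ) ((p : ℕ), l)) :
    Set.BijOn (restrict (removeCell_le hb)) {T ∈ boundedTableaux μ c | T p l = m}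
      (boundedTableaux (removeCell μ _ hb) c) := by
  refine ⟨fun T hT i j hmem => ?_, fun S hS T hT h => ?_, fun T hT => ?_⟩
  · rw [restrict_apply, if_pos hmem]
    exact hT.1 i j (removeCell_le hb hmem)
  · ext i j
    by_cases hmem : (i, j) ∈ removeCell μ _ hb
    · simpa [restrict_apply, hmem] using congrFun (DFunLike.congr_fun h i) j
    · rw [mem_removeCell, not_and_or, not_not] at hmem
      obtain heq | hmem := hmem
      · obtain ⟨rfl, rfl⟩ := Prod.mk.inj heq
        exact hS.2.trans hT.2.symm
      · rw [S.zeros hmem, T.zeros hmem]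
  · have hrow (j) (hj : j < l) : T p j ≤ m := by
      have := hT p j (mem_removeCell.2 ⟨by simp [hj.ne], μ.up_left_mem le_rfl hj.le hb.prop⟩)
      lia
    have hcol (i) (hi : i < (p : ℕ)) : T i l < m :=
      (hT ⟨i, hi.trans p.2⟩ l
        (mem_removeCell.2 ⟨by simp [hi.ne], μ.up_left_mem hi.le le_rfl hb.prop⟩)).trans_le
        (hlt _ hi)
    refine ⟨insertCell T m hrow hcol, ⟨fun i j hmem => ?_, ?_⟩, restrict_insertCell T hrow hcol⟩
    · rw [insertCell_apply]
      split_ifs with h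
      · obtain rfl : i = p := Fin.ext (Prod.mk.inj h).1
        lia
      · exact hT i j (mem_removeCell.2 ⟨h, hmem⟩)
    · rw [insertCell_apply, if_pos rfl]

theorem flaggedSchur_eq_add (x : ℕ → A) (hμ : ∀ b ∈ μ, b.1 < n) (hp : c p = m + 1)
    (hlt : ∀ i < p, c i ≤ m) {l : ℕ} (hb : Maximal (· ∈ μ) ((p : ℕ), l)) :
    flaggedSchur x μ c = flaggedSchur x μ (Function.update c p m) +
      x m * flaggedSchur x (removeCell μ _ hb) c := by
  have hfin := finite_boundedTableaux hμ c
  rw [flaggedSchur, boundedTableaux_eq_union hp hb,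
    finsum_mem_union (disjoint_boundedTableaux_update hb.prop)
      (hfin.subset (boundedTableaux_update_subset hp)) (hfin.subset (Set.sep_subset _ _)),
    flaggedSchur, flaggedSchur, mul_finsum_mem']
  · refine congrArg _ (finsum_mem_eq_of_bijOn _ (bijOn_restrict_removeCell hp hlt hb)
      fun T hT => ?_)
    rw [← mul_prod_erase μ.cells _ hb.prop, hT.2]
    refine congrArg _ (prod_congr rfl fun b hmem => ?_)
    rw [restrict_apply, if_pos (show (b.1, b.2) ∈ removeCell μ _ hb from hmem)]
  · exact finite_boundedTableaux (fun b hmem => hμ b (removeCell_le hb hmem)) c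

end FlaggedSchur

/-! ### The flagged Jacobi–Trudi identity -/

section FlaggedJacobiTrudi

variable {A : Type*} [CommRing A] {x : ℕ → A} {μ : YoungDiagram} {n : ℕ}

/-- The degrees `μ_j - j` in the Jacobi–Trudi matrix of the shape `μ`. -/
def jtDegree (μ : YoungDiagram) (n : ℕ) : Fin n → ℤ :=
  fun j => (μ.rowLen j : ℤ) - (j : ℕ)

theorem jtDegree_removeCell {p : Fin n} (hb : Maximal (· ∈ μ) ((p : ℕ), μ.rowLen p - 1)) :
    jtDegree (removeCell μ _ hb) n = Function.update (jtDegree μ n) p (jtDegree μ n p - 1) := by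
  ext j
  have hpos := YoungDiagram.mem_iff_lt_rowLen.1 hb.prop
  simp only [jtDegree, rowLen_removeCell, Function.update_apply, Fin.val_inj]
  split_ifs with h
  · subst h
    lia
  · rfl

theorem det_jtMatrix_jtDegree_castSucc {c : Fin (n + 1) → ℕ} (hc : ∀ j, c j ≤ n) :
    (jtMatrix x (jtDegree μ (n + 1)) c).det =
      if μ.rowLen n = 0 then (jtMatrix x (jtDegree μ n) fun j => c j.castSucc).det else 0 := by
  have hdeg (j : Fin n) : jtDegree μ (n + 1) j.castSucc + n ≠ 0 := by
    have := j.is_lt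
    simp only [jtDegree, Fin.val_castSucc]
    lia
  have hlast : jtDegree μ (n + 1) (Fin.last n) + n = 0 ↔ μ.rowLen n = 0 := by simp [jtDegree]
  rw [det_jtMatrix_castSucc hc hdeg, if_congr hlast rfl rfl]
  rfl

theorem det_jtMatrix_update_of_not_corner {c : Fin n → ℕ} (hμ : ∀ b ∈ μ, b.1 < n) {p : Fin n}
    (h : μ.rowLen p ≤ μ.rowLen (p + 1)) (hc : ∀ q > p, c q = c p) :
    (jtMatrix x (Function.update (jtDegree μ n) p (jtDegree μ n p - 1)) c).det = 0 := by
  have hrow : μ.rowLen (p + 1) = μ.rowLen p := (μ.rowLen_anti _ _ p.1.le_succ).antisymm h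
  obtain hpn | hpn := (Nat.succ_le_of_lt p.2).lt_or_eq
  · have hq : (⟨p + 1, hpn⟩ : Fin n) > p := Fin.lt_def.2 p.1.lt_succ_self
    refine det_jtMatrix_eq_zero_of_eq hq.ne ?_ (hc _ hq).symm
    rw [Function.update_self, Function.update_of_ne hq.ne', jtDegree, jtDegree, hrow]
    push_cast
    ring
  · have hzero : μ.rowLen (p + 1) = 0 := by
      by_contra hne
      exact (hμ _ (YoungDiagram.mem_iff_lt_rowLen.2 (Nat.pos_of_ne_zero hne))).ne hpn
    refine det_jtMatrix_eq_zero_of_neg (p := p) fun i => ?_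
    have := i.is_lt
    rw [Function.update_self, jtDegree]
    lia

theorem flaggedSchur_eq_det_of_lower {c : Fin n → ℕ} (hμ : ∀ b ∈ μ, b.1 < n) {p : Fin n} {m : ℕ}
    (hp : c p = m + 1) (hm : n ≤ m + 1) (hlt : ∀ i < p, c i ≤ m) (hgt : ∀ i > p, c i = m + 1)
    (hlower : flaggedSchur x μ (Function.update c p m) =
      (jtMatrix x (jtDegree μ n) (Function.update c p m)).det)
    (hremove : ∀ (b : ℕ × ℕ) (hb : Maximal (· ∈ μ) b), flaggedSchur x (removeCell μ b hb) c =
      (jtMatrix x (jtDegree (removeCell μ b hb) n) c).det) :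
    flaggedSchur x μ c = (jtMatrix x (jtDegree μ n) c).det := by
  rw [det_jtMatrix_eq_add hp hm, ← hlower]
  obtain hcorner | hcorner := lt_or_ge (μ.rowLen (p + 1)) (μ.rowLen p)
  · have hb := maximal_rowLen hcorner
    rw [flaggedSchur_eq_add x hμ hp hlt hb, hremove, jtDegree_removeCell]
  · have hnext (j) (hmem : ((p : ℕ), j) ∈ μ) :
        ∃ q : Fin n, p < q ∧ ((q : ℕ), j) ∈ μ ∧ c q ≤ m + 1 := by
      have hmem' : ((p : ℕ) + 1, j) ∈ μ := YoungDiagram.mem_iff_lt_rowLen.2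
        ((YoungDiagram.mem_iff_lt_rowLen.1 hmem).trans_le hcorner)
      have hq : p < (⟨p + 1, hμ _ hmem'⟩ : Fin n) := Fin.lt_def.2 p.1.lt_succ_self
      exact ⟨_, hq, hmem', (hgt _ hq).le⟩
    rw [det_jtMatrix_update_of_not_corner hμ hcorner fun q hq => (hgt q hq).trans hp.symm,
      mul_zero, add_zero, flaggedSchur, flaggedSchur, boundedTableaux_update_of_not_corner hp hnext]

theorem monotone_update {ι α : Type*} [LinearOrder ι] [Preorder α] {c : ι → α} (hc : Monotone c)
    {p : ι} {m : α} (hp : m ≤ c p) (hlt : ∀ i < p, c i ≤ m) : Monotone (Function.update c p m) := by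
  intro i j hij
  simp only [Function.update_apply]
  split_ifs with hi hj hj
  · rfl
  · exact hp.trans (hc (hi ▸ hij))
  · exact hlt i (lt_of_le_of_ne (hj ▸ hij) hi)
  · exact hc hij

theorem flaggedSchur_eq_det (x : ℕ → A) {n : ℕ} {μ : YoungDiagram} (hμ : ∀ b ∈ μ, b.1 < n)
    {c : Fin n → ℕ} (hc : Monotone c) :
    flaggedSchur x μ c = (jtMatrix x (jtDegree μ n) c).det := by
  induction hN : n + ∑ i, c i + μ.card using Nat.strong_induction_on generalizing n μ with | _ N ih
  subst hN
  obtain _ | n := n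
  · rw [flaggedSchur_eq_one (fun b hb => absurd (hμ b hb) (Nat.not_lt_zero _)),
      Matrix.det_isEmpty]
  obtain hlast | hlast := le_or_gt (c (Fin.last n)) n
  · rw [flaggedSchur_castSucc hlast,
      det_jtMatrix_jtDegree_castSucc fun j => (hc (Fin.le_last j)).trans hlast]
    split_ifs with hrow
    · have hμ' (b) (hb : b ∈ μ) : b.1 < n := by
        have hle := Nat.lt_succ_iff.1 (hμ b hb)
        refine hle.lt_of_ne fun h => ?_
        have := YoungDiagram.mem_iff_lt_rowLen.1 hb
        lia
      exact ih _ (by rw [Fin.sum_univ_castSucc]; lia) hμ'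
        (hc.comp (Fin.strictMono_castSucc).monotone) rfl
    · rfl
  · obtain ⟨p, hp, hmin⟩ := wellFounded_lt.has_min {p | c p = c (Fin.last n)} ⟨_, rfl⟩
    obtain ⟨m, hm⟩ : ∃ m, c (Fin.last n) = m + 1 := Nat.exists_eq_add_one_of_ne_zero (by lia)
    have hpm : c p = m + 1 := hp.trans hm
    have hlt (i) (hi : i < p) : c i ≤ m := by
      have hne : c i ≠ c (Fin.last n) := fun h => hmin i h hi
      have := hc (Fin.le_last i)
      lia
    refine flaggedSchur_eq_det_of_lower hμ hpm (by lia) hlt (fun i hi => ?_) ?_ fun b hb => ?_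
    · exact le_antisymm (hm ▸ hc (Fin.le_last i)) (hpm ▸ hc hi.le)
    · have hsum : ∑ i, Function.update c p m i < ∑ i, c i :=
        Fintype.sum_strictMono (update_lt_self_iff.2 (by lia))
      exact ih _ (by lia) hμ (monotone_update hc (by lia) hlt) rfl
    · have hcard : (removeCell μ b hb).card < μ.card := card_erase_lt_of_mem hb.prop
      exact ih _ (by lia) (fun b' hb' => hμ b' (removeCell_le hb hb')) hc rfl

end FlaggedJacobiTrudi

/-! ### Implied row bounds -/

section Tightening

theorem det_eq_of_col_sub_mem_span {ι A : Type*} [Fintype ι] [LinearOrder ι] [CommRing A]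
    {M N : Matrix ι ι A}
    (h : ∀ z, M.col z - N.col z ∈ Submodule.span A (N.col '' Set.Ioi z)) : M.det = N.det := by
  classical
  have hcomb (z) : ∃ f : ι → A, ∑ w with z < w, f w • N.col w = M.col z - N.col z :=
    (Submodule.mem_span_image_finset_iff_exists_fun' A).1 (by simpa [Set.Ioi_def] using h z)
  choose f hf using hcomb
  let F : Matrix ι ι A := Matrix.of fun w z => if z < w then f z w else 0
  have hM : M = N * (1 + F) := by
    ext i z
    have hfz : ∑ w with z < w, f z w * N i w = M i z - N i z := by
      simpa using congrFun (hf z) i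
    rw [mul_add, mul_one, Matrix.add_apply, ← sub_eq_iff_eq_add', ← hfz, Matrix.mul_apply,
      sum_filter]
    simp [F, mul_comm]
  have hdet : (1 + F).det = 1 := by
    rw [Matrix.det_of_isLowerTriangular]
    · simp [F]
    · intro w z hwz
      have hlt : w < z := hwz
      simp [F, hlt.ne, hlt.not_gt]
  rw [hM, Matrix.det_mul, hdet, mul_one]

variable {A : Type*} [CommRing A] {x : ℕ → A} {μ : YoungDiagram} {n : ℕ} {b c : Fin n → ℕ}

theorem jtCol_sub_mem_span {a : ℤ} {k : ℕ} (h : 1 ≤ a + k) (d : ℕ) :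
    jtCol x n a k - jtCol x n a (k + d) ∈
      Submodule.span A ((fun s : ℕ => jtCol x n (a - s) (k + d)) '' Set.Icc 1 d) := by
  induction d generalizing a k with
  | zero => simp
  | succ d ih =>
    have hstep : jtCol x n a (k + 1) = jtCol x n a k + x k • jtCol x n (a - 1) (k + 1) :=
      jtCol_add_one fun i => by lia
    have hsame := ih (a := a) (k := k + 1) (by push_cast; lia)
    have hlower := ih (a := a - 1) (k := k + 1) (by push_cast; lia)
    rw [add_assoc, add_comm 1 d] at hsame hlower
    have hsplit : jtCol x n a k - jtCol x n a (k + (d + 1)) =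
        (jtCol x n a (k + 1) - jtCol x n a (k + (d + 1))) -
          x k • ((jtCol x n (a - 1) (k + 1) - jtCol x n (a - 1) (k + (d + 1))) +
            jtCol x n (a - 1) (k + (d + 1))) := by
      rw [hstep, sub_add_cancel]
      abel
    rw [hsplit]
    refine sub_mem (Submodule.span_mono ?_ hsame) (Submodule.smul_mem _ _ (add_mem
      (Submodule.span_mono ?_ hlower) (Submodule.subset_span ⟨1, by simp, by simp⟩)))
    · exact Set.image_mono (Set.Icc_subset_Icc_right d.le_succ)
    · rintro _ ⟨s, ⟨-, hs₂⟩, rfl⟩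
      exact ⟨s + 1, ⟨by lia, by lia⟩, by simp [sub_sub, add_comm]⟩

/-- `b` lowers the weakly larger bounds `c` only as far as each bound `b z` still follows from the
bound at the end `y` of a block of rows of equal length and equal bounds `c`, because the columns
of a tableau increase strictly. -/
def IsTightening (μ : YoungDiagram) (b c : Fin n → ℕ) : Prop :=
  ∀ z, b z ≤ c z ∧ ∃ y, z ≤ y ∧ c z ≤ b z + (y - z) ∧
    ∀ w ∈ Set.Icc z y, μ.rowLen w = μ.rowLen z ∧ c w = c z

theorem IsTightening.boundedTableaux_eq (h : IsTightening μ b c) :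
    boundedTableaux μ b = boundedTableaux μ c := by
  refine Set.Subset.antisymm (fun T hT i j hmem => (hT i j hmem).trans_le (h i).1)
    fun T hT z j hmem => ?_
  obtain ⟨-, y, hzy, hslack, hblock⟩ := h z
  obtain ⟨hrow, hcy⟩ := hblock y ⟨hzy, le_rfl⟩
  have hmem' : ((y : ℕ), j) ∈ μ := by
    rwa [YoungDiagram.mem_iff_lt_rowLen, hrow, ← YoungDiagram.mem_iff_lt_rowLen]
  have hcol := entry_add_sub_le T (Fin.le_def.1 hzy) hmem'
  have hTy := hT y j hmem'
  lia

theorem IsTightening.det_jtMatrix_eq (h : IsTightening μ b c) (hb : ∀ z, z < b z) :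
    (jtMatrix x (jtDegree μ n) b).det = (jtMatrix x (jtDegree μ n) c).det := by
  refine det_eq_of_col_sub_mem_span fun z => ?_
  obtain ⟨hle, y, hzy, hslack, hblock⟩ := h z
  obtain ⟨d, hd⟩ := Nat.exists_eq_add_of_le hle
  have hspan := jtCol_sub_mem_span (x := x) (n := n) (a := jtDegree μ n z) (k := b z) (by
    have := hb z
    simp only [jtDegree]
    lia) d
  rw [← hd] at hspan
  refine Submodule.span_mono ?_ hspan
  rintro _ ⟨s, ⟨hs₁, hs₂⟩, rfl⟩
  have hws : (z : ℕ) + s ≤ y := by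
    have := Fin.le_def.1 hzy
    lia
  let w : Fin n := ⟨z + s, hws.trans_lt y.2⟩
  obtain ⟨hrow, hcw⟩ := hblock w ⟨Fin.le_def.2 (Nat.le_add_right _ _), hws⟩
  refine ⟨w, Fin.lt_def.2 (Nat.lt_add_of_pos_right hs₁), funext fun i => ?_⟩
  have hdeg : jtDegree μ n w = jtDegree μ n z - s := by
    rw [jtDegree, jtDegree, hrow]
    simp only [w]
    push_cast
    ring
  simp only [Matrix.col_apply, jtMatrix, Matrix.of_apply, hdeg, hcw]

end Tightening

/-! ### Row bound sums and platforms -/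

section RowBoundSum

variable {n : ℕ} {lam : Fin n → ℕ} {hlam : Antitone lam}

theorem mem_shape_coe {i : Fin n} {j : ℕ} : ((i : ℕ), j) ∈ shape lam hlam ↔ j < lam i := by
  simp [← YoungDiagram.mem_cells, shape, Fin.val_inj]

theorem fst_lt_of_mem_shape {b : ℕ × ℕ} (hb : b ∈ shape lam hlam) : b.1 < n := by
  obtain ⟨i, -, hi⟩ := mem_biUnion.1 ((YoungDiagram.mem_cells _).2 hb)
  obtain ⟨j, -, rfl⟩ := mem_image.1 hi
  exact i.2

theorem rowLen_shape (i : Fin n) : (shape lam hlam).rowLen i = lam i :=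
  eq_of_forall_lt_iff fun j => by rw [← YoungDiagram.mem_iff_lt_rowLen, mem_shape_coe]

theorem rowBoundSet_eq_boundedTableaux (β : Fin n → Fin n) :
    rowBoundSet lam hlam β = boundedTableaux (shape lam hlam) fun i => (β i : ℕ) + 1 := by
  ext T
  constructor
  · exact fun hT i j hmem => Nat.lt_succ_iff.2 (hT.2 i j (mem_shape_coe.1 hmem))
  · refine fun hT => ⟨fun b hb => ?_, fun i j hj => Nat.lt_succ_iff.1 (hT i j (mem_shape_coe.2 hj))⟩
    have hlt := hT ⟨b.1, fst_lt_of_mem_shape hb⟩ b.2 hb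
    exact hlt.trans_le (Nat.succ_le_of_lt (Fin.is_lt _))

/-- The variables `X 0, …, X (n - 1)`, extended by zero to a sequence. -/
noncomputable def varSeq (n : ℕ) : ℕ → MvPolynomial (Fin n) ℤ :=
  Function.extend Fin.val MvPolynomial.X 0

theorem varSeq_coe (k : Fin n) : varSeq n k = MvPolynomial.X k :=
  Fin.val_injective.extend_apply _ _ k

theorem prod_X_pow_content {μ : YoungDiagram} {T : SemistandardYoungTableau μ}
    (hT : ∀ b ∈ μ.cells, T b.1 b.2 < n) :
    ∏ k : Fin n, MvPolynomial.X k ^ content T k = ∏ b ∈ μ.cells, varSeq n (T b.1 b.2) := by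
  rw [← prod_fiberwise_of_maps_to (t := range n) (g := fun b => T b.1 b.2)
    fun b hb => mem_range.2 (hT b hb), prod_range]
  refine prod_congr rfl fun k _ => ?_
  rw [prod_congr rfl fun b hb => by rw [(mem_filter.1 hb).2, varSeq_coe], prod_const, content]

theorem rowBoundSum_eq_flaggedSchur (β : Fin n → Fin n) :
    rowBoundSum lam hlam β =
      flaggedSchur (varSeq n) (shape lam hlam) fun i => (β i : ℕ) + 1 := by
  rw [flaggedSchur, ← rowBoundSet_eq_boundedTableaux,
    finsum_mem_eq_finite_toFinset_sum _ (rowBoundSet_finite lam hlam β), rowBoundSum]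
  exact sum_congr rfl fun T hT => prod_X_pow_content ((Set.Finite.mem_toFinset _).1 hT).1

theorem completeHom_eq_hsymmInt (u : ℤ) (i k : Fin n) :
    completeHom u i k = hsymmInt (varSeq n) (Ico (i : ℕ) (k + 1)) u := by
  classical
  have hvars : varSeq n ∘ Fin.valOrderEmb n = MvPolynomial.X := funext varSeq_coe
  have hIco : Ico (i : ℕ) (k + 1) = (Icc i k).map (Fin.valOrderEmb n).toEmbedding := by
    rw [Ico_add_one_right_eq_Icc]
    exact (Fin.map_valEmbedding_Icc i k).symm
  rw [completeHom, hsymmInt, hIco, hsymm_map, hvars]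
  refine if_congr Iff.rfl rfl (sum_congr (ext fun t => ?_) fun _ _ => rfl)
  simp [mem_monotoneTuples, and_comm]

theorem completeHom_matrix_eq_jtMatrix (β : Fin n → Fin n) :
    (Matrix.of fun i j : Fin n =>
        completeHom ((lam j : ℤ) - ((j : ℕ) : ℤ) + ((i : ℕ) : ℤ)) i (β j)) =
      jtMatrix (varSeq n) (jtDegree (shape lam hlam) n) fun j => (β j : ℕ) + 1 := by
  ext1 i j
  simp only [Matrix.of_apply, jtMatrix, jtCol, jtDegree, completeHom_eq_hsymmInt, rowLen_shape]

end RowBoundSum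

section Platform

variable {n : ℕ} {R : Finset ℕ} {β : Fin n → Fin n} {i j k l x : Fin n}

theorem SameCarrel.symm (h : SameCarrel R i k) : SameCarrel R k i :=
  fun q hq => (h q hq).symm

theorem SameCarrel.trans (h : SameCarrel R i k) (h' : SameCarrel R k l) : SameCarrel R i l :=
  fun q hq => (h q hq).trans (h' q hq)

theorem SameCarrel.of_le_of_le (h : SameCarrel R i l) (hik : i ≤ k) (hkl : k ≤ l) :
    SameCarrel R i k := fun q hq => by
  have := h q hq
  lia

theorem nextCritical_spec (R : Finset ℕ) (β : Fin n → Fin n) (i : Fin n) :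
    IsCritical R β (nextCritical R β i) ∧ SameCarrel R i (nextCritical R β i) ∧
      i ≤ nextCritical R β i := by
  classical
  have h : nextCritical R β i ∈ univ.filter fun x => IsCritical R β x ∧ SameCarrel R i x ∧ i ≤ x :=
    min'_mem _ _
  exact (mem_filter.1 h).2

theorem nextCritical_le (hx : IsCritical R β x) (hc : SameCarrel R i x) (hix : i ≤ x) :
    nextCritical R β i ≤ x := by
  classical
  exact min'_le _ _ (by simpa using ⟨hx, hc, hix⟩)

theorem nextCritical_eq_self (hi : IsCritical R β i) : nextCritical R β i = i :=
  (nextCritical_le hi (fun _ _ => Iff.rfl) le_rfl).antisymm (nextCritical_spec R β i).2.2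

theorem nextCritical_eq_of_le (hik : i ≤ k) (hk : k ≤ nextCritical R β i) :
    nextCritical R β k = nextCritical R β i := by
  obtain ⟨hi₁, hi₂, -⟩ := nextCritical_spec R β i
  obtain ⟨hk₁, hk₂, hk₃⟩ := nextCritical_spec R β k
  have hc := hi₂.of_le_of_le hik hk
  exact (nextCritical_le hi₁ (hc.symm.trans hi₂) hk).antisymm
    (nextCritical_le hk₁ (hc.trans hk₂) (hik.trans hk₃))

theorem not_steepRise_nextCritical (R : Finset ℕ) (β : Fin n → Fin n) (i : Fin n) :
    ¬ SteepRise β i (nextCritical R β i) := by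
  intro h
  obtain ⟨hcrit, hc, hle⟩ := nextCritical_spec R β i
  have hlt : i < nextCritical R β i := hle.lt_of_ne fun he => by
    rw [← he] at h
    simp [SteepRise] at h
  obtain ⟨z, ⟨hiz, hzlt, hsteep⟩, hmax⟩ := wellFounded_gt.has_min
    {z | i ≤ z ∧ z < nextCritical R β i ∧ SteepRise β z (nextCritical R β i)} ⟨i, le_rfl, hlt, h⟩
  have hciz := hc.of_le_of_le hiz hzlt.le
  have hzcrit : IsCritical R β z := .next z _ hcrit hzlt (hciz.symm.trans hc) hsteep
    fun w hzw hw hs => hmax w ⟨hiz.trans hzw.le, hw, hs⟩ hzw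
  exact (nextCritical_le hzcrit hciz hiz).not_gt hzlt

theorem le_platform_of_isCritical (h : HasFlagCriticalList R β) (hi : IsCritical R β i)
    (hij : (i : ℕ) + 1 = j) : β i ≤ platform R β j := by
  obtain ⟨hcrit, hc, hle⟩ := nextCritical_spec R β j
  by_cases hR : (i : ℕ) + 1 ∈ R
  · refine h _ hR i j _ rfl hij.symm ⟨⟨hcrit, hc⟩, fun x hx => nextCritical_le hx.1 hx.2 ?_⟩
    have := hx.2 _ hR
    lia
  obtain ⟨_, hend⟩ | ⟨_, y, hy, hiy, hciy, hsteep, hmax⟩ := hi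
  · obtain hmem | hn := hend
    · exact absurd hmem hR
    · lia
  · have hjy : j ≤ y := by lia
    have hcjy := (hciy.of_le_of_le (by lia) hjy).symm.trans hciy
    obtain heq | hlt := (nextCritical_le hy hcjy hjy).eq_or_lt
    · rw [platform, heq]
      rw [SteepRise] at hsteep
      rw [Fin.le_def]
      omega
    · have hnot := hmax _ (by lia) hlt
      rw [SteepRise] at hsteep hnot
      rw [platform, Fin.le_def]
      omega

theorem platform_monotone (h : HasFlagCriticalList R β) : Monotone (platform R β) := by
  refine (monotone_iff_forall_covBy _).2 fun i j hij => ?_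
  have hsucc : (i : ℕ) + 1 = j := (Nat.covBy_iff_add_one_eq).1 (Fin.covBy_iff.1 hij)
  by_cases hi : IsCritical R β i
  · rw [platform, nextCritical_eq_self hi]
    exact le_platform_of_isCritical h hi hsucc
  · obtain ⟨hcrit, -, hle⟩ := nextCritical_spec R β i
    have hne : i ≠ nextCritical R β i := fun he => hi (he ▸ hcrit)
    have hj : j ≤ nextCritical R β i := by lia
    rw [platform, platform, nextCritical_eq_of_le hij.le hj]

theorem rowLen_eq_of_sameCarrel {lam : Fin n → ℕ} {hlam : Antitone lam} (hik : i ≤ k)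
    (h : SameCarrel (colLengths lam hlam) i k) :
    (shape lam hlam).rowLen k = (shape lam hlam).rowLen i := by
  set μ := shape lam hlam
  by_contra hne
  have hlt : μ.rowLen k < μ.rowLen i := (μ.rowLen_anti _ _ hik).lt_of_ne hne
  have hi : i < μ.colLen (μ.rowLen k) :=
    YoungDiagram.mem_iff_lt_colLen.1 (YoungDiagram.mem_iff_lt_rowLen.2 hlt)
  have hk : μ.colLen (μ.rowLen k) ≤ k := not_lt.1 fun hlt =>
    (YoungDiagram.mem_iff_lt_rowLen.1 (YoungDiagram.mem_iff_lt_colLen.2 hlt)).false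
  have hmem : μ.colLen (μ.rowLen k) ∈ colLengths lam hlam :=
    mem_filter.2 ⟨mem_image_of_mem _ (mem_range.2 (hlt.trans_le (μ.rowLen_anti _ _ i.1.zero_le))),
      hk.trans_lt k.2⟩
  exact ((h _ hmem).2 hk).not_gt hi

theorem isTightening_platform {lam : Fin n → ℕ} {hlam : Antitone lam}
    (h : β ≤ platform (colLengths lam hlam) β) :
    IsTightening (shape lam hlam) (fun i => (β i : ℕ) + 1)
      fun i => (platform (colLengths lam hlam) β i : ℕ) + 1 := by
  intro z
  obtain ⟨-, hc, hle⟩ := nextCritical_spec (colLengths lam hlam) β z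
  refine ⟨Nat.succ_le_succ (h z), _, hle, ?_, fun w ⟨hzw, hw⟩ => ⟨?_, ?_⟩⟩
  · have := not_steepRise_nextCritical (colLengths lam hlam) β z
    rw [SteepRise] at this
    simp only [platform]
    omega
  · exact rowLen_eq_of_sameCarrel hzw (hc.of_le_of_le hzw hw)
  · simp only [platform, nextCritical_eq_of_le hzw hw]

end Platform

end RowBound

theorem corollary5p2 (n : ℕ) (lam : Fin n → ℕ) (hlam : Antitone lam) (β : Fin n → Fin n)
    (hU : β ∈ RowBound.U n)
    (hβ : β ∈ RowBound.UGC n (RowBound.colLengths lam hlam) ∩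
      RowBound.UBP n (RowBound.colLengths lam hlam)) :
    RowBound.rowBoundSum lam hlam β =
      Matrix.det (Matrix.of fun i j : Fin n =>
        RowBound.completeHom ((lam j : ℤ) - ((j : ℕ) : ℤ) + ((i : ℕ) : ℤ)) i (β j)) := by
  open RowBound in
  obtain ⟨⟨-, hflag⟩, -, hplat⟩ := hβ
  have htight := isTightening_platform hplat
  have hmono : Monotone fun i => (platform (colLengths lam hlam) β i : ℕ) + 1 :=
    fun i j hij => Nat.succ_le_succ (platform_monotone hflag hij)
  rw [rowBoundSum_eq_flaggedSchur, flaggedSchur, htight.boundedTableaux_eq, ← flaggedSchur,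
    flaggedSchur_eq_det _ (fun b => fst_lt_of_mem_shape) hmono,
    ← htight.det_jtMatrix_eq fun z => Nat.lt_succ_iff.2 (hU z), completeHom_matrix_eq_jtMatrix]
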